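/- Consider one mode with Hilbert space $L^2(\mathbb R)$, $\hat q$ being multiplication by the variable, $\hat p=-i\,d/dy$, $\hat a=(\hat q+i\hat p)/\sqrt2$, and $D(\xi)=\exp(\xi\hat a^\dagger-\xi^*\hat a)$ for $\xi\in\mathbb C$. For $-1\le s\le 1$ and a density operator $\rho$ (a positive trace-class operator of trace one), let $\chi_s(\xi;\rho)=e^{s|\xi|^2/2}\,\mathrm{Tr}(\rho D(\xi))$ be its $s$-ordered characteristic function, and let $$\Lambda_s(\alpha;\rho)=\pi^{-1}\int_{\mathbb C}e^{\alpha\xi^*-\alpha^*\xi}\,\chi_s(\xi;\rho)\,d^2\xi$$ be its $s$-ordered quasiprobability, understood as a generalized function acting on the Fourier transforms of smooth compactly supported functions. For real $a\neq0$ the scaling map $\Gamma_{s,a}$ is defined by $\Lambda_s(\alpha;\Gamma_{s,a}(\rho))=a^{-2}\Lambda_s(a^{-1}\alpha;\rho)$. It is called positive if for every density operator $\rho$ the scaled function $a^{-2}\Lambda_s(a^{-1}\alpha;\rho)$ is again the $s$-ordered quasiprobability of some density operator. Then $\Gamma_{s,a}$ is not positive in each of the following cases: $-1<s<1$ and $|a|\neq1$;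 $s=-1$ and $|a|<1$; $s=1$ and $|a|>1$ (always with $a\in\mathbb R\setminus\{0\}$). -/

import Mathlib

open MeasureTheory Complex
open scoped ContDiff InnerProductSpace ComplexConjugate

namespace ScalingMap

noncomputable section

/-- The Hilbert space `L²(ℝ)` of one mode, in the Schrödinger representation:
`q̂` is multiplication by the variable and `p̂ = -i d/dy`, so that `[q̂, p̂] = i`. -/
abbrev ModeSpace : Type := Lp ℂ 2 (volume : Measure ℝ)

/-! ### Displacement operators -/

/-- The pointwise formula for `D(ξ) ψ`. -/
def displaceFun (ξ : ℂ) (ψ : ℝ → ℂ) (y : ℝ) : ℂ :=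
  cexp (((Real.sqrt 2 * ξ.im * y - ξ.re * ξ.im : ℝ) : ℂ) * I) * ψ (y - Real.sqrt 2 * ξ.re)

lemma displaceFun_congr (ξ : ℂ) {f g : ℝ → ℂ} (h : f =ᵐ[volume] g) :
    displaceFun ξ f =ᵐ[volume] displaceFun ξ g := by
  have h2 := (measurePreserving_sub_right (volume : Measure ℝ)
    (Real.sqrt 2 * ξ.re)).quasiMeasurePreserving.ae_eq_comp h
  filter_upwards [h2] with y hy
  simp only [Function.comp_apply] at hy
  simp only [displaceFun, hy]

lemma norm_displaceFun (ξ : ℂ) (f : ℝ → ℂ) (y : ℝ) :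
    ‖displaceFun ξ f y‖ = ‖f (y - Real.sqrt 2 * ξ.re)‖ := by
  rw [displaceFun, norm_mul, norm_exp_ofReal_mul_I, one_mul]

lemma eLpNorm_displaceFun (ξ : ℂ) {f : ℝ → ℂ} (hf : AEStronglyMeasurable f volume) :
    eLpNorm (displaceFun ξ f) 2 volume = eLpNorm f 2 volume := by
  rw [← eLpNorm_comp_measurePreserving hf
    (measurePreserving_sub_right (volume : Measure ℝ) (Real.sqrt 2 * ξ.re))]
  exact eLpNorm_congr_norm_ae (Filter.Eventually.of_forall fun y => norm_displaceFun ξ f y)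

lemma memLp_displaceFun (ξ : ℂ) {f : ℝ → ℂ} (hf : MemLp f 2 volume) :
    MemLp (displaceFun ξ f) 2 volume := by
  refine ⟨?_, ?_⟩
  · have h1 : AEStronglyMeasurable (fun y : ℝ => f (y - Real.sqrt 2 * ξ.re)) volume :=
      hf.1.comp_measurePreserving
        (measurePreserving_sub_right (volume : Measure ℝ) (Real.sqrt 2 * ξ.re))
    have h2 : Continuous (fun y : ℝ =>
        cexp (((Real.sqrt 2 * ξ.im * y - ξ.re * ξ.im : ℝ) : ℂ) * I)) := by fun_prop
    exact h2.aestronglyMeasurable.mul h1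
  · rw [eLpNorm_displaceFun ξ hf.1]
    exact hf.2

/-- The displacement operator `D(ξ) = exp (ξ â† - ξ* â)`, where `â = (q̂ + i p̂) / √2`.
With `ξ = (x + i p) / √2` it is `exp (i (p q̂ - x p̂))`, which acts by
`(D(ξ) ψ)(y) = exp (i p y - i p x / 2) ψ(y - x)`. -/
def displacement (ξ : ℂ) : ModeSpace →L[ℂ] ModeSpace :=
  LinearIsometry.toContinuousLinearMap
    { toFun := fun ψ => (memLp_displaceFun ξ (Lp.memLp ψ)).toLp
      map_add' := fun ψ φ => by
        rw [← MemLp.toLp_add, MemLp.toLp_eq_toLp_iff]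
        refine (displaceFun_congr ξ (Lp.coeFn_add ψ φ)).trans ?_
        exact Filter.Eventually.of_forall fun y => by
          simp [displaceFun, mul_add]
      map_smul' := fun c ψ => by
        rw [RingHom.id_apply, ← MemLp.toLp_const_smul, MemLp.toLp_eq_toLp_iff]
        refine (displaceFun_congr ξ (Lp.coeFn_smul c ψ)).trans ?_
        exact Filter.Eventually.of_forall fun y => by
          simp only [displaceFun, Pi.smul_apply, smul_eq_mul]; ring
      norm_map' := fun ψ => by
        change ‖(memLp_displaceFun ξ (Lp.memLp ψ)).toLp‖ = ‖ψ‖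
        rw [Lp.norm_toLp, eLpNorm_displaceFun ξ (Lp.memLp ψ).1, Lp.norm_def] }

lemma displacement_coeFn (ξ : ℂ) (ψ : ModeSpace) :
    displacement ξ ψ =ᵐ[volume] displaceFun ξ ψ :=
  MemLp.coeFn_toLp (memLp_displaceFun ξ (Lp.memLp ψ))

/-! ### Trace and density operators -/

/-- The index set of an orthonormal basis of `L²(ℝ)`. -/
def basisIndex : Set ModeSpace := (exists_hilbertBasis ℂ ModeSpace).choose

/-- An orthonormal basis of `L²(ℝ)`. It is used only to write down traces of trace-class
operators, which do not depend on the basis. -/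
def basis : HilbertBasis basisIndex ℂ ModeSpace :=
  (exists_hilbertBasis ℂ ModeSpace).choose_spec.choose

/-- The trace of a (trace-class) operator. -/
def trace (T : ModeSpace →L[ℂ] ModeSpace) : ℂ := ∑' i, ⟪basis i, T (basis i)⟫_ℂ

/-- Density operators: positive trace-class operators of trace one. (A positive operator is
trace class exactly when the sum of its diagonal entries in an orthonormal basis
converges.) -/
structure IsDensityOperator (ρ : ModeSpace →L[ℂ] ModeSpace) : Prop where
  isPositive : ρ.IsPositive
  hasSum_one : HasSum (fun i => ⟪basis i, ρ (basis i)⟫_ℂ) 1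

/-! ### Characteristic functions and quasiprobabilities -/

/-- The `s`-ordered characteristic function `χ_s(ξ; ρ) = exp (s |ξ|² / 2) Tr (ρ D(ξ))`. -/
def charFun (s : ℝ) (ρ : ModeSpace →L[ℂ] ModeSpace) (ξ : ℂ) : ℂ :=
  ((Real.exp (s * ‖ξ‖ ^ 2 / 2) : ℝ) : ℂ) * trace (ρ ∘L displacement ξ)

/-- The (involutive) Fourier transform of phase space,
`g ↦ π⁻¹ ∫ exp (α ξ* - α* ξ) g(ξ) d²ξ`. -/
def fourierPS (g : ℂ → ℂ) (α : ℂ) : ℂ :=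
  (Real.pi : ℂ)⁻¹ * ∫ ξ : ℂ, cexp (α * conj ξ - conj α * ξ) * g ξ

/-- Test functions on phase space: the Fourier transforms of smooth compactly supported
functions. For `s > 0` the function `χ_s` may grow like a Gaussian, and its Fourier transform
is then a generalized function on this space of test functions only. -/
structure TestFunction where
  toFun : ℂ → ℂ
  exists_eq_fourierPS : ∃ φ : ℂ → ℂ, ContDiff ℝ ∞ φ ∧ HasCompactSupport φ ∧ toFun = fourierPS φ

/-- The test function `α ↦ f(a α)`. -/
def TestFunction.dilate (a : ℝ) (ha : a ≠ 0) (f : TestFunction) : TestFunction where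
  toFun := fun α => f.toFun (a * α)
  exists_eq_fourierPS := by
    obtain ⟨φ, hφ, hc, hf⟩ := f.exists_eq_fourierPS
    refine ⟨fun ξ => ((a ^ 2)⁻¹ : ℝ) • φ (a⁻¹ • ξ), ?_, ?_, ?_⟩
    · exact (hφ.comp (contDiff_const_smul a⁻¹)).const_smul _
    · exact (hc.comp_smul (inv_ne_zero ha)).smul_left (f := fun _ => ((a ^ 2)⁻¹ : ℝ))
    · funext α
      rw [hf]
      simp only [fourierPS]
      congr 1
      have h := Measure.integral_comp_smul (volume : Measure ℂ)
        (fun ξ : ℂ => cexp (α * conj ξ - conj α * ξ) * (((a ^ 2)⁻¹ : ℝ) • φ (a⁻¹ • ξ))) a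
      have ha2 : |(a ^ 2)⁻¹| = (a ^ 2)⁻¹ := abs_of_nonneg (by positivity)
      have ha3 : (a ^ 2)⁻¹ ≠ 0 := inv_ne_zero (pow_ne_zero 2 ha)
      rw [Complex.finrank_real_complex, ha2] at h
      apply smul_right_injective ℂ ha3
      dsimp only
      rw [← h, ← integral_smul]
      congr 1
      funext ξ
      rw [inv_smul_smul₀ ha, mul_smul_comm]
      congr 3
      simp only [real_smul, map_mul, conj_ofReal]
      ring

/-- A generalized function on phase space, as a functional `f ↦ ∫ Λ(α) f(α) d²α` on test
functions. -/
abbrev GeneralizedFunction : Type := TestFunction → ℂ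

/-- The `s`-ordered quasiprobability `Λ_s(·; ρ)`, the Fourier transform of `χ_s(·; ρ)`:
`∫ Λ_s(α) f(α) d²α = ∫ χ_s(ξ) (π⁻¹ ∫ exp (α ξ* - α* ξ) f(α) d²α) d²ξ`. The inner integral is
a smooth compactly supported function of `ξ`. -/
def quasiprobability (s : ℝ) (ρ : ModeSpace →L[ℂ] ModeSpace) : GeneralizedFunction :=
  fun f => ∫ ξ : ℂ, charFun s ρ ξ * fourierPS f.toFun (-ξ)

/-- Where `Λ_s` is given by a convergent Fourier integral, `quasiprobability` is integration
against that function. -/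
lemma quasiprobability_eq_integral (s : ℝ) (ρ : ModeSpace →L[ℂ] ModeSpace) (f : TestFunction)
    (hχ : Integrable (charFun s ρ)) (hf : Integrable f.toFun) :
    quasiprobability s ρ f = ∫ α : ℂ, fourierPS (charFun s ρ) α * f.toFun α := by
  set K : ℂ → ℂ → ℂ := fun ξ α =>
    (Real.pi : ℂ)⁻¹ * (cexp (α * conj ξ - conj α * ξ) * (charFun s ρ ξ * f.toFun α)) with hK
  have hint : Integrable (Function.uncurry K) ((volume : Measure ℂ).prod volume) := by
    refine Integrable.const_mul ?_ _
    refine (hχ.mul_prod hf).bdd_mul (c := 1) ?_ ?_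
    · exact Continuous.aestronglyMeasurable (by fun_prop)
    · refine Filter.Eventually.of_forall fun z => ?_
      rw [norm_exp]
      simp [mul_comm]
  calc quasiprobability s ρ f = ∫ ξ : ℂ, ∫ α : ℂ, K ξ α := by
        refine integral_congr_ae (Filter.Eventually.of_forall fun ξ => ?_)
        simp only [fourierPS, hK, ← integral_const_mul]
        refine integral_congr_ae (Filter.Eventually.of_forall fun α => ?_)
        have : -ξ * conj α - conj (-ξ) * α = α * conj ξ - conj α * ξ := by
          rw [map_neg]; ring
        simp only [this]
        ring
    _ = ∫ α : ℂ, ∫ ξ : ℂ, K ξ α := integral_integral_swap hint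
    _ = _ := by
        refine integral_congr_ae (Filter.Eventually.of_forall fun α => ?_)
        simp only [fourierPS, hK, ← integral_const_mul, ← integral_mul_const]
        refine integral_congr_ae (Filter.Eventually.of_forall fun ξ => ?_)
        simp only []
        ring

/-- The generalized function `α ↦ a⁻² Λ(a⁻¹ α)`:
`∫ a⁻² Λ(a⁻¹ α) f(α) d²α = ∫ Λ(α) f(a α) d²α`. -/
def GeneralizedFunction.scale (a : ℝ) (ha : a ≠ 0) (Λ : GeneralizedFunction) :
    GeneralizedFunction :=
  fun f => Λ (f.dilate a ha)

/-! ### Scaling maps -/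

/-- `Λ` is an `s`-ordered quasiprobability: it is `Λ_s(·; ρ)` for some density operator. -/
def IsQuasiprobability (s : ℝ) (Λ : GeneralizedFunction) : Prop :=
  ∃ ρ : ModeSpace →L[ℂ] ModeSpace, IsDensityOperator ρ ∧ Λ = quasiprobability s ρ

/-- The scaling map `Γ_{s,a}`, given by
`Λ_s(α; Γ_{s,a}(ρ)) = a⁻² Λ_s(a⁻¹ α; ρ)`, is positive: it takes every `s`-ordered
quasiprobability to an `s`-ordered quasiprobability. -/
def IsPositiveScalingMap (s a : ℝ) (ha : a ≠ 0) : Prop :=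
  ∀ Λ : GeneralizedFunction, IsQuasiprobability s Λ → IsQuasiprobability s (Λ.scale a ha)

end

end ScalingMap

/-!
The map `Γ_{s,a}` acts on `Tr (ρ D(ξ))` by
`χ(ξ) ↦ exp (s (a² - 1) |ξ|² / 2) χ(a ξ)`. Applied to one of the two lowest Fock states it yields a
function which would give a negative occupation probability to the other one, so that it is not the
characteristic function of a density operator.

The state `|k⟩`, `k ∈ {0, 1}`, has `χ(ξ) = (1 - k |ξ|²) exp (-|ξ|² / 2)`
(`inner_fock_displacement_fock`). Weakly, `∫ ⟪m|D(ξ)|m⟫ D(ξ) d²ξ = π |m⟩⟨m|`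
(`integral_fockChar_mul_inner`, an explicit Gaussian integral), hence
`∫ ⟪m|D(ξ)|m⟫ Tr (σ D(ξ)) d²ξ = π ⟪m|σ|m⟫ ≥ 0` for every density operator `σ`
(`IsDensityOperator.integral_fockChar_mul_trace`). For the scaled state `|k⟩` and `m = 1 - k` the
left side is `π (c - B) / c²` with `c = (1 + s + a² (1 - s)) / 2 > 0` and `B = 1 - k + k a²`. It is
negative for `k = 0` if `|a| < 1` and `s < 1`, and for `k = 1` if `|a| > 1` and `s > -1`; these are
the cases of the theorem.

Two analytic points support this. The trace of `σ D(ξ)` is an absolutely convergent series, uniformly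
in `ξ`, because `σ` is the square of a Hilbert–Schmidt operator (`IsDensityOperator.tsum_enorm_le`);
this allows integrating it term by term. And a quasiprobability, which is only a functional on
Fourier transforms of smooth compactly supported functions, determines the characteristic function
almost everywhere, by Fourier inversion on phase space (`fourierPS_fourierPS`,
`charFun_ae_eq_of_scale_eq`).
-/

namespace ScalingMap

/-! ### Gaussian moments -/

lemma integrable_pow_mul_gaussian {b : ℝ} (hb : 0 < b) (n : ℕ) :
    Integrable fun u : ℝ => u ^ n * Real.exp (-b * u ^ 2) := by
  have h := integrable_rpow_mul_exp_neg_mul_sq hb (s := n)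
    (by have : (0 : ℝ) ≤ n := n.cast_nonneg
        linarith)
  simpa only [Real.rpow_natCast] using h

lemma integrable_pow_mul_cexp {b : ℝ} (hb : 0 < b) (t : ℝ) (n : ℕ) :
    Integrable fun u : ℝ => (u : ℂ) ^ n * cexp (-b * u ^ 2 + I * t * u) := by
  refine (integrable_pow_mul_gaussian hb n).norm.mono' ?_ ?_
  · exact Continuous.aestronglyMeasurable (by fun_prop)
  · refine Filter.Eventually.of_forall fun u => le_of_eq ?_
    rw [norm_mul, norm_exp, norm_mul, Real.norm_eq_abs (Real.exp _), Real.abs_exp, norm_pow,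
      norm_pow, norm_real]
    congr 2
    simp [← ofReal_pow]

lemma integral_cexp_gaussian {b : ℝ} (hb : 0 < b) (t : ℝ) :
    ∫ u : ℝ, cexp (-b * u ^ 2 + I * t * u) =
      ((Real.sqrt (Real.pi / b) * Real.exp (-t ^ 2 / (4 * b)) : ℝ) : ℂ) := by
  have h := fourierIntegral_gaussian (b := (b : ℂ)) (by simpa using hb) t
  simp_rw [← Complex.exp_add] at h
  rw [Real.sqrt_eq_rpow, ofReal_mul, ofReal_cpow (by positivity)]
  push_cast
  rw [← h]
  refine integral_congr_ae (Filter.Eventually.of_forall fun u => ?_)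
  dsimp only
  rw [add_comm]

/-- The Fourier transform of an even quadratic polynomial times a Gaussian. The second moment
comes from the vanishing of the integrals of the derivatives of `E` and of `u E`, where
`E(u) = exp (-b u² + i t u)`. -/
lemma integral_quadratic_mul_cexp_gaussian {b : ℝ} (hb : 0 < b) (t : ℝ) (A B : ℂ) :
    ∫ u : ℝ, (A + B * u ^ 2) * cexp (-b * u ^ 2 + I * t * u) =
      (A + B * ((1 - t ^ 2 / (2 * b)) / (2 * b))) *
        ((Real.sqrt (Real.pi / b) * Real.exp (-t ^ 2 / (4 * b)) : ℝ) : ℂ) := by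
  have i0 := integrable_pow_mul_cexp hb t 0
  have i1 := integrable_pow_mul_cexp hb t 1
  have i2 := integrable_pow_mul_cexp hb t 2
  simp only [pow_zero, one_mul, pow_one] at i0 i1
  have dE : ∀ u : ℝ, HasDerivAt (fun u : ℝ => cexp (-b * u ^ 2 + I * t * u))
      (-(2 * b) * ((u : ℂ) * cexp (-b * u ^ 2 + I * t * u))
        + I * t * cexp (-b * u ^ 2 + I * t * u)) u := by
    intro u
    have h1 : HasDerivAt (fun u : ℝ => (u : ℂ)) 1 u := ofRealCLM.hasDerivAt
    have h2 := (((h1.pow 2).const_mul (-b : ℂ)).add (h1.const_mul (I * t))).cexp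
    convert! h2 using 1
    simp
    ring
  have dF : ∀ u : ℝ, HasDerivAt (fun u : ℝ => (u : ℂ) * cexp (-b * u ^ 2 + I * t * u))
      (cexp (-b * u ^ 2 + I * t * u) + (-(2 * b) * ((u : ℂ) ^ 2 * cexp (-b * u ^ 2 + I * t * u))
        + I * t * ((u : ℂ) * cexp (-b * u ^ 2 + I * t * u)))) u := by
    intro u
    have h1 : HasDerivAt (fun u : ℝ => (u : ℂ)) 1 u := ofRealCLM.hasDerivAt
    convert! h1.mul (dE u) using 1
    ring
  have e1 := integral_eq_zero_of_hasDerivAt_of_integrable dE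
    ((i1.const_mul _).add (i0.const_mul _)) i0
  have e2 := integral_eq_zero_of_hasDerivAt_of_integrable dF
    (i0.add ((i2.const_mul _).add (i1.const_mul _))) i1
  rw [integral_add (i1.const_mul _) (i0.const_mul _), integral_const_mul, integral_const_mul] at e1
  have i3 : Integrable fun u : ℝ => -(2 * b) * ((u : ℂ) ^ 2 * cexp (-b * u ^ 2 + I * t * u))
        + I * t * ((u : ℂ) * cexp (-b * u ^ 2 + I * t * u)) :=
    (i2.const_mul _).add (i1.const_mul _)
  rw [integral_add i0 i3, integral_add (i2.const_mul _) (i1.const_mul _), integral_const_mul,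
    integral_const_mul] at e2
  have hsplit : ∫ u : ℝ, (A + B * u ^ 2) * cexp (-b * u ^ 2 + I * t * u) =
      A * (∫ u : ℝ, cexp (-b * u ^ 2 + I * t * u)) +
        B * ∫ u : ℝ, (u : ℂ) ^ 2 * cexp (-b * u ^ 2 + I * t * u) := by
    rw [← integral_const_mul, ← integral_const_mul,
      ← integral_add (i0.const_mul _) (i2.const_mul _)]
    refine integral_congr_ae (Filter.Eventually.of_forall fun u => ?_)
    dsimp only
    ring
  rw [hsplit, ← integral_cexp_gaussian hb t]
  have hb' : (b : ℂ) ≠ 0 := ofReal_ne_zero.2 hb.ne'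
  generalize (∫ u : ℝ, cexp (-b * u ^ 2 + I * t * u)) = J0 at *
  generalize (∫ u : ℝ, (u : ℂ) * cexp (-b * u ^ 2 + I * t * u)) = J1 at *
  generalize (∫ u : ℝ, (u : ℂ) ^ 2 * cexp (-b * u ^ 2 + I * t * u)) = J2 at *
  have hJ1 : J1 = I * t * J0 / (2 * b) := by
    field_simp
    linear_combination -e1
  have hJ2 : J2 = (J0 + I * t * J1) / (2 * b) := by
    field_simp
    linear_combination -e2
  rw [hJ2, hJ1]
  field_simp
  linear_combination (B * t ^ 2 * J0) * I_sq

lemma integrable_quadratic_mul_exp_neg_norm_sq {c : ℝ} (hc : 0 < c) (A B : ℝ) :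
    Integrable fun ξ : ℂ => (A + B * ‖ξ‖ ^ 2) * Real.exp (-c * ‖ξ‖ ^ 2) := by
  have key : ∀ n : ℕ, Integrable fun ξ : ℂ => ‖ξ‖ ^ (2 * n) * Real.exp (-c * ‖ξ‖ ^ 2) := by
    intro n
    have h := Complex.integral_rpow_mul_exp_neg_mul_rpow (p := 2) (q := (2 * n : ℕ)) one_le_two
      (by have : (0 : ℝ) ≤ (2 * n : ℕ) := Nat.cast_nonneg _
          linarith) hc
    -- A non-zero Bochner integral forces integrability.
    refine not_imp_comm.1 integral_undef ?_
    simp only [Real.rpow_natCast, Real.rpow_two] at h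
    rw [h]
    have : 0 < (((2 * n : ℕ) : ℝ) + 2) / 2 := by positivity
    have := Real.Gamma_pos_of_pos this
    positivity
  have h0 := key 0
  have h1 := key 1
  simp only [mul_zero, pow_zero, one_mul, mul_one] at h0 h1
  convert! (h0.const_mul A).add (h1.const_mul B) using 1
  funext ξ
  simp only [Pi.add_apply]
  ring

lemma integral_quadratic_mul_exp_neg_norm_sq {c : ℝ} (hc : 0 < c) (A B : ℝ) :
    ∫ ξ : ℂ, (A + B * ‖ξ‖ ^ 2) * Real.exp (-c * ‖ξ‖ ^ 2) = Real.pi * (A / c + B / c ^ 2) := by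
  have h0 := Complex.integral_rpow_mul_exp_neg_mul_rpow (p := 2) (q := 0) one_le_two
    (by norm_num) hc
  have h1 := Complex.integral_rpow_mul_exp_neg_mul_rpow (p := 2) (q := 2) one_le_two
    (by norm_num) hc
  have i0 := integrable_quadratic_mul_exp_neg_norm_sq hc 1 0
  have i1 := integrable_quadratic_mul_exp_neg_norm_sq hc 0 1
  simp only [Real.rpow_two, Real.rpow_zero, one_mul, zero_mul, add_zero, zero_add] at h0 h1 i0 i1
  have e0 : -(2 : ℝ) / 2 = -1 := by norm_num
  have e1 : -(2 + 2 : ℝ) / 2 = -(2 : ℕ) := by norm_num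
  have e2 : (2 + 2 : ℝ) / 2 = (1 : ℕ) + 1 := by norm_num
  rw [e0, Real.rpow_neg_one, div_self two_ne_zero, Real.Gamma_one] at h0
  rw [e1, Real.rpow_neg hc.le, Real.rpow_natCast, e2, Real.Gamma_nat_eq_factorial] at h1
  have : ∀ ξ : ℂ, (A + B * ‖ξ‖ ^ 2) * Real.exp (-c * ‖ξ‖ ^ 2) =
      A * Real.exp (-c * ‖ξ‖ ^ 2) + B * (‖ξ‖ ^ 2 * Real.exp (-c * ‖ξ‖ ^ 2)) := fun ξ => by ring
  simp_rw [this]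
  rw [integral_add (i0.const_mul A) (i1.const_mul B), integral_const_mul, integral_const_mul,
    h0, h1]
  simp
  ring

/-! ### Matrix elements of displacement operators -/

lemma inner_displacement (ξ : ℂ) (η ψ : ModeSpace) :
    ⟪η, displacement ξ ψ⟫_ℂ = ∫ y : ℝ, conj (η y) * displaceFun ξ ψ y := by
  rw [L2.inner_def]
  refine integral_congr_ae ?_
  filter_upwards [displacement_coeFn ξ ψ] with y hy
  rw [hy, RCLike.inner_apply, mul_comm]

lemma stronglyMeasurable_displaceFun (ψ : ModeSpace) :
    StronglyMeasurable fun z : ℂ × ℝ => displaceFun z.1 ψ z.2 := by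
  unfold displaceFun
  refine StronglyMeasurable.mul (Continuous.stronglyMeasurable (by fun_prop)) ?_
  exact (Lp.stronglyMeasurable ψ).comp_measurable (by fun_prop)

lemma stronglyMeasurable_inner_integrand (η ψ : ModeSpace) :
    StronglyMeasurable fun z : ℂ × ℝ => conj (η z.2) * displaceFun z.1 ψ z.2 :=
  (continuous_conj.comp_stronglyMeasurable
    ((Lp.stronglyMeasurable η).comp_measurable measurable_snd)).mul
    (stronglyMeasurable_displaceFun ψ)

lemma stronglyMeasurable_inner_displacement (η ψ : ModeSpace) :
    StronglyMeasurable fun ξ : ℂ => ⟪η, displacement ξ ψ⟫_ℂ := by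
  simp_rw [inner_displacement]
  exact (stronglyMeasurable_inner_integrand η ψ).integral_prod_right

lemma integrable_norm_sq (ψ : ModeSpace) : Integrable fun y : ℝ => ‖ψ y‖ ^ 2 :=
  (memLp_two_iff_integrable_sq_norm (Lp.memLp ψ).1).1 (Lp.memLp ψ)

lemma integrable_norm_displaceFun_sq (ξ : ℂ) (ψ : ModeSpace) :
    Integrable fun y : ℝ => ‖displaceFun ξ ψ y‖ ^ 2 := by
  simp_rw [norm_displaceFun]
  exact (integrable_norm_sq ψ).comp_sub_right (Real.sqrt 2 * ξ.re)

lemma integral_norm_displaceFun_sq (ξ : ℂ) (ψ : ModeSpace) :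
    ∫ y : ℝ, ‖displaceFun ξ ψ y‖ ^ 2 = ∫ y : ℝ, ‖ψ y‖ ^ 2 := by
  simp_rw [norm_displaceFun]
  exact integral_sub_right_eq_self (fun y : ℝ => ‖ψ y‖ ^ 2) (Real.sqrt 2 * ξ.re)

lemma norm_inner_integrand_le (ξ : ℂ) (η ψ : ModeSpace) (y : ℝ) :
    ‖conj (η y) * displaceFun ξ ψ y‖ ≤ (‖η y‖ ^ 2 + ‖displaceFun ξ ψ y‖ ^ 2) / 2 := by
  rw [norm_mul, RCLike.norm_conj]
  nlinarith [sq_nonneg (‖η y‖ - ‖displaceFun ξ ψ y‖)]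

lemma integrable_inner_integrand (ξ : ℂ) (η ψ : ModeSpace) :
    Integrable fun y : ℝ => conj (η y) * displaceFun ξ ψ y :=
  (((integrable_norm_sq η).add (integrable_norm_displaceFun_sq ξ ψ)).div_const 2).mono'
    ((stronglyMeasurable_inner_integrand η ψ).comp_measurable
      measurable_prodMk_left).aestronglyMeasurable
    (Filter.Eventually.of_forall fun y => norm_inner_integrand_le ξ η ψ y)

/-- For integrable `g` the double integral defining `∫ g(ξ) ⟪η, D(ξ) ψ⟫ d²ξ` converges
absolutely. -/
lemma integrable_mul_inner_integrand {g : ℂ → ℂ} (hg : Integrable g) (η ψ : ModeSpace) :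
    Integrable (fun z : ℂ × ℝ => g z.1 * (conj (η z.2) * displaceFun z.1 ψ z.2))
      ((volume : Measure ℂ).prod volume) := by
  have hm : AEStronglyMeasurable
      (fun z : ℂ × ℝ => g z.1 * (conj (η z.2) * displaceFun z.1 ψ z.2))
      ((volume : Measure ℂ).prod volume) :=
    hg.1.comp_fst.mul (stronglyMeasurable_inner_integrand η ψ).aestronglyMeasurable
  refine (integrable_prod_iff hm).2
    ⟨Filter.Eventually.of_forall fun ξ => (integrable_inner_integrand ξ η ψ).const_mul (g ξ), ?_⟩
  refine (hg.norm.mul_const (((∫ y : ℝ, ‖η y‖ ^ 2) + ∫ y : ℝ, ‖ψ y‖ ^ 2) / 2)).mono'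
    hm.norm.integral_prod_right' (Filter.Eventually.of_forall fun ξ => ?_)
  rw [Real.norm_of_nonneg (integral_nonneg fun _ => norm_nonneg _)]
  simp_rw [norm_mul (g ξ)]
  rw [integral_const_mul]
  refine mul_le_mul_of_nonneg_left ?_ (norm_nonneg _)
  rw [← integral_norm_displaceFun_sq ξ ψ,
    ← integral_add (integrable_norm_sq η) (integrable_norm_displaceFun_sq ξ ψ),
    ← integral_div]
  exact integral_mono (integrable_inner_integrand ξ η ψ).norm
    (((integrable_norm_sq η).add (integrable_norm_displaceFun_sq ξ ψ)).div_const 2)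
    fun y => norm_inner_integrand_le ξ η ψ y

/-! ### The two lowest Fock states -/

/-- The wave function of the Fock state `|k⟩` for `k = 0` and `k = 1`, written as one formula:
`π^(-1/4) exp (-y² / 2)` and `π^(-1/4) √2 y exp (-y² / 2)`. For other `k` it has no meaning. -/
noncomputable def fockFun (k y : ℝ) : ℂ :=
  (((Real.sqrt (Real.sqrt Real.pi))⁻¹ * (1 - k + k * (Real.sqrt 2 * y)) *
    Real.exp (-y ^ 2 / 2) : ℝ) : ℂ)

/-- The characteristic function `(1 - k |ξ|²) exp (-|ξ|² / 2)` of the Fock state `|k⟩`,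
for `k = 0` and `k = 1`. -/
noncomputable def fockChar (k : ℝ) (ξ : ℂ) : ℝ :=
  (1 - k * ‖ξ‖ ^ 2) * Real.exp (-‖ξ‖ ^ 2 / 2)

lemma conj_fockFun (k y : ℝ) : conj (fockFun k y) = fockFun k y := conj_ofReal _

lemma fockFun_mul {k : ℝ} (hk : k = 0 ∨ k = 1) (y z : ℝ) :
    fockFun k y * fockFun k z = (((Real.sqrt Real.pi)⁻¹ * (1 - k + 2 * k * (y * z)) *
      Real.exp (-(y ^ 2 + z ^ 2) / 2) : ℝ) : ℂ) := by
  have h1 : (Real.sqrt (Real.sqrt Real.pi))⁻¹ * (Real.sqrt (Real.sqrt Real.pi))⁻¹ =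
      (Real.sqrt Real.pi)⁻¹ := by
    rw [← mul_inv, Real.mul_self_sqrt (Real.sqrt_nonneg _)]
  have h2 : Real.sqrt 2 * Real.sqrt 2 = 2 := Real.mul_self_sqrt zero_le_two
  have h3 : Real.exp (-(y ^ 2 + z ^ 2) / 2) = Real.exp (-y ^ 2 / 2) * Real.exp (-z ^ 2 / 2) := by
    rw [← Real.exp_add]
    ring_nf
  rw [fockFun, fockFun, ← ofReal_mul, h3, ← h1]
  congr 1
  rcases hk with rfl | rfl
  · ring
  · linear_combination (Real.sqrt (Real.sqrt Real.pi))⁻¹ * (Real.sqrt (Real.sqrt Real.pi))⁻¹ *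
      y * z * Real.exp (-y ^ 2 / 2) * Real.exp (-z ^ 2 / 2) * h2

lemma continuous_fockFun (k : ℝ) : Continuous (fockFun k) := by
  unfold fockFun
  fun_prop

lemma memLp_fockFun (k : ℝ) : MemLp (fockFun k) 2 volume := by
  rw [memLp_two_iff_integrable_sq_norm (continuous_fockFun k).aestronglyMeasurable]
  have i0 := integrable_pow_mul_gaussian one_pos 0
  have i1 := integrable_pow_mul_gaussian one_pos 1
  have i2 := integrable_pow_mul_gaussian one_pos 2
  convert! (((i0.const_mul ((1 - k) ^ 2)).add (i1.const_mul (2 * Real.sqrt 2 * k * (1 - k)))).add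
    (i2.const_mul ((Real.sqrt 2 * k) ^ 2))).const_mul ((Real.sqrt (Real.sqrt Real.pi))⁻¹ ^ 2)
    using 1
  funext y
  have h : Real.exp (-1 * y ^ 2) = Real.exp (-y ^ 2 / 2) ^ 2 := by
    rw [← Real.exp_nat_mul]
    congr 1
    push_cast
    ring
  simp only [fockFun, norm_real, Real.norm_eq_abs, sq_abs, Pi.add_apply, h]
  ring

/-- The Fock state `|k⟩`, for `k = 0` and `k = 1`. -/
noncomputable def fock (k : ℝ) : ModeSpace := (memLp_fockFun k).toLp

lemma fock_coeFn (k : ℝ) : fock k =ᵐ[volume] fockFun k := MemLp.coeFn_toLp _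

lemma norm_sq_eq_re_im (ξ : ℂ) : ‖ξ‖ ^ 2 = ξ.re ^ 2 + ξ.im ^ 2 := by
  rw [Complex.sq_norm, normSq_apply]
  ring

lemma integrable_fockChar (k : ℝ) : Integrable (fockChar k) := by
  convert! integrable_quadratic_mul_exp_neg_norm_sq (c := 1 / 2) (by norm_num) 1 (-k) using 1
  funext ξ
  rw [fockChar]
  ring_nf

lemma inner_fock_displacement_fock {k : ℝ} (hk : k = 0 ∨ k = 1) (ξ : ℂ) :
    ⟪fock k, displacement ξ (fock k)⟫_ℂ = fockChar k ξ := by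
  have h2 : Real.sqrt 2 * Real.sqrt 2 = 2 := Real.mul_self_sqrt zero_le_two
  have hπ : Real.sqrt Real.pi ≠ 0 := (Real.sqrt_pos.2 Real.pi_pos).ne'
  rw [inner_displacement]
  calc ∫ y : ℝ, conj (fock k y) * displaceFun ξ (fock k) y
      = ∫ y : ℝ, conj (fockFun k y) * displaceFun ξ (fockFun k) y := by
        refine integral_congr_ae ?_
        filter_upwards [fock_coeFn k, displaceFun_congr ξ (fock_coeFn k)] with y h1 h2
        rw [h1, h2]
    -- The midpoint between the two centres is the new origin: it removes the phase `Re ξ Im ξ`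
    -- and makes the polynomial even.
    _ = ∫ t : ℝ, conj (fockFun k (t + Real.sqrt 2 * ξ.re / 2)) *
          displaceFun ξ (fockFun k) (t + Real.sqrt 2 * ξ.re / 2) :=
        (integral_add_right_eq_self (fun y : ℝ => conj (fockFun k y) *
          displaceFun ξ (fockFun k) y) (Real.sqrt 2 * ξ.re / 2)).symm
    _ = ∫ t : ℝ, (((Real.sqrt Real.pi)⁻¹ * Real.exp (-ξ.re ^ 2 / 2) : ℝ) : ℂ) *
          (((1 - k - k * ξ.re ^ 2 : ℝ) + (2 * k : ℝ) * t ^ 2) *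
            cexp (-(1 : ℝ) * t ^ 2 + I * (Real.sqrt 2 * ξ.im : ℝ) * t)) := by
        refine integral_congr_ae (Filter.Eventually.of_forall fun t => ?_)
        dsimp only
        rw [conj_fockFun, displaceFun, mul_left_comm, fockFun_mul hk]
        have e1 : -((t + Real.sqrt 2 * ξ.re / 2) ^ 2 +
            (t + Real.sqrt 2 * ξ.re / 2 - Real.sqrt 2 * ξ.re) ^ 2) / 2 =
            -ξ.re ^ 2 / 2 + -t ^ 2 := by
          linear_combination (-ξ.re ^ 2 / 4) * h2
        have e2 : Real.sqrt 2 * ξ.im * (t + Real.sqrt 2 * ξ.re / 2) - ξ.re * ξ.im =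
            Real.sqrt 2 * ξ.im * t := by
          linear_combination (ξ.re * ξ.im / 2) * h2
        have e3 : 1 - k + 2 * k * ((t + Real.sqrt 2 * ξ.re / 2) *
            (t + Real.sqrt 2 * ξ.re / 2 - Real.sqrt 2 * ξ.re)) =
            (1 - k - k * ξ.re ^ 2) + 2 * k * t ^ 2 := by
          linear_combination (-k * ξ.re ^ 2 / 2) * h2
        rw [e1, e2, e3, Real.exp_add, Complex.exp_add]
        push_cast
        ring_nf
    _ = fockChar k ξ := by
        rw [integral_const_mul, integral_quadratic_mul_cexp_gaussian one_pos, fockChar,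
          norm_sq_eq_re_im]
        have e1 : -(Real.sqrt 2 * ξ.im) ^ 2 / (4 * 1) = -ξ.im ^ 2 / 2 := by
          linear_combination (-ξ.im ^ 2 / 4) * h2
        have e2 : -(ξ.re ^ 2 + ξ.im ^ 2) / 2 = -ξ.re ^ 2 / 2 + -ξ.im ^ 2 / 2 := by ring
        rw [e1, e2, Real.exp_add, div_one]
        norm_cast
        field_simp
        linear_combination (-2 * k * ξ.im ^ 2) * h2

lemma displacement_zero (ψ : ModeSpace) : displacement 0 ψ = ψ := by
  refine Lp.ext ?_
  filter_upwards [displacement_coeFn 0 ψ] with y hy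
  rw [hy]
  simp [displaceFun]

lemma inner_fock_self {k : ℝ} (hk : k = 0 ∨ k = 1) : ⟪fock k, fock k⟫_ℂ = 1 := by
  have h := inner_fock_displacement_fock hk 0
  rw [displacement_zero] at h
  simpa [fockChar] using h

/-- The integral over the imaginary part of `ξ` in the reproducing formula for `fock k`. -/
lemma integral_fockChar_mul_cexp {k : ℝ} (hk : k = 0 ∨ k = 1) (u y : ℝ) :
    ∫ v : ℝ, (fockChar k (u + v * I) : ℂ) *
      cexp (((Real.sqrt 2 * v * y - u * v : ℝ) : ℂ) * I) =
    ((Real.sqrt 2 * Real.pi : ℝ) : ℂ) * (fockFun k y * fockFun k (y - Real.sqrt 2 * u)) := by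
  have h2 : Real.sqrt 2 * Real.sqrt 2 = 2 := Real.mul_self_sqrt zero_le_two
  have hπ : Real.sqrt Real.pi ≠ 0 := (Real.sqrt_pos.2 Real.pi_pos).ne'
  have hππ : Real.sqrt Real.pi * Real.sqrt Real.pi = Real.pi := Real.mul_self_sqrt Real.pi_pos.le
  calc ∫ v : ℝ, (fockChar k (u + v * I) : ℂ) *
        cexp (((Real.sqrt 2 * v * y - u * v : ℝ) : ℂ) * I)
      = ∫ v : ℝ, ((Real.exp (-u ^ 2 / 2) : ℝ) : ℂ) *
          (((1 - k * u ^ 2 : ℝ) + (-k : ℝ) * v ^ 2) *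
            cexp (-(1 / 2 : ℝ) * v ^ 2 + I * (Real.sqrt 2 * y - u : ℝ) * v)) := by
        refine integral_congr_ae (Filter.Eventually.of_forall fun v => ?_)
        dsimp only
        have e : ‖(u + v * I : ℂ)‖ ^ 2 = u ^ 2 + v ^ 2 := by
          rw [norm_sq_eq_re_im]
          simp
        have e2 : -(u ^ 2 + v ^ 2) / 2 = -u ^ 2 / 2 + -v ^ 2 / 2 := by ring
        rw [fockChar, e, e2, Real.exp_add, Complex.exp_add]
        push_cast
        ring_nf
    _ = _ := by
        rw [integral_const_mul, integral_quadratic_mul_cexp_gaussian one_half_pos, fockFun_mul hk]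
        have e1 : Real.pi / (1 / 2) = 2 * Real.pi := by ring
        have e2 : -(y ^ 2 + (y - Real.sqrt 2 * u) ^ 2) / 2 =
            -u ^ 2 / 2 + -(Real.sqrt 2 * y - u) ^ 2 / (4 * (1 / 2)) := by
          linear_combination ((y ^ 2 - u ^ 2) / 2) * h2
        rw [e1, e2, Real.exp_add, Real.sqrt_mul zero_le_two]
        norm_cast
        generalize Real.sqrt Real.pi = r at hπ hππ ⊢
        rw [← hππ]
        field_simp
        linear_combination (k * y ^ 2) * h2

/-- The orthogonality relation of displacement operators for a Fock state: weakly,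
`∫ ⟪k|D(ξ)|k⟫ D(ξ) d²ξ = π |k⟩⟨k|` (the weight is even and real). -/
lemma integral_fockChar_mul_inner {k : ℝ} (hk : k = 0 ∨ k = 1) (η ψ : ModeSpace) :
    ∫ ξ : ℂ, (fockChar k ξ : ℂ) * ⟪η, displacement ξ ψ⟫_ℂ =
      Real.pi * (⟪η, fock k⟫_ℂ * ⟪fock k, ψ⟫_ℂ) := by
  have hint := integrable_mul_inner_integrand (integrable_fockChar k).ofReal η ψ
  have hs : Real.sqrt 2 ≠ 0 := by positivity
  have inner_fock : ∫ y : ℝ, fockFun k y * ψ y = ⟪fock k, ψ⟫_ℂ := by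
    rw [L2.inner_def]
    refine integral_congr_ae ?_
    filter_upwards [fock_coeFn k] with y hy
    rw [hy, RCLike.inner_apply, conj_fockFun, mul_comm]
  have hy : ∀ᵐ y : ℝ, ∫ ξ : ℂ, (fockChar k ξ : ℂ) * (conj (η y) * displaceFun ξ ψ y) =
      (Real.pi * ⟪fock k, ψ⟫_ℂ) * (conj (η y) * fockFun k y) := by
    filter_upwards [hint.prod_left_ae] with y hy
    have hmp := volume_preserving_equiv_real_prod.symm
    have hme := measurableEquivRealProd.symm.measurableEmbedding
    have hi := (hmp.integrable_comp_emb hme).2 hy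
    rw [← hmp.integral_comp hme, Measure.volume_eq_prod,
      integral_prod (fun z : ℝ × ℝ => (fockChar k (measurableEquivRealProd.symm z) : ℂ) *
        (conj (η y) * displaceFun (measurableEquivRealProd.symm z) ψ y)) hi]
    have hu : ∀ u : ℝ, (∫ v : ℝ, (fockChar k (measurableEquivRealProd.symm (u, v)) : ℂ) *
        (conj (η y) * displaceFun (measurableEquivRealProd.symm (u, v)) ψ y)) =
        ((Real.sqrt 2 * Real.pi : ℝ) * conj (η y) * fockFun k y) *
          (fockFun k (y - Real.sqrt 2 * u) * ψ (y - Real.sqrt 2 * u)) := by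
      intro u
      have h := integral_fockChar_mul_cexp hk u y
      have hz : ∀ v : ℝ, measurableEquivRealProd.symm (u, v) = (u + v * I : ℂ) := fun v => by
        apply Complex.ext <;> simp [measurableEquivRealProd_symm_apply]
      have : ∀ v : ℝ, (fockChar k (measurableEquivRealProd.symm (u, v)) : ℂ) *
          (conj (η y) * displaceFun (measurableEquivRealProd.symm (u, v)) ψ y) =
          ((fockChar k (u + v * I) : ℂ) *
            cexp (((Real.sqrt 2 * v * y - u * v : ℝ) : ℂ) * I)) *
            (conj (η y) * ψ (y - Real.sqrt 2 * u)) := fun v => by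
        rw [hz, displaceFun]
        simp
        ring
      simp_rw [this]
      rw [integral_mul_const, h]
      ring
    simp_rw [hu]
    rw [integral_const_mul]
    have hcv : ∫ u : ℝ, fockFun k (y - Real.sqrt 2 * u) * ψ (y - Real.sqrt 2 * u) =
        ((Real.sqrt 2)⁻¹ : ℝ) * ⟪fock k, ψ⟫_ℂ := by
      rw [← inner_fock, ← integral_sub_left_eq_self (fun y : ℝ => fockFun k y * ψ y) volume y]
      have := Measure.integral_comp_mul_left
        (fun u : ℝ => fockFun k (y - u) * ψ (y - u)) (Real.sqrt 2)
      rw [this, abs_of_pos (by positivity), real_smul]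
    rw [hcv]
    push_cast
    have hs' : (Real.sqrt 2 : ℂ) ≠ 0 := ofReal_ne_zero.2 hs
    field_simp
  calc ∫ ξ : ℂ, (fockChar k ξ : ℂ) * ⟪η, displacement ξ ψ⟫_ℂ
      = ∫ ξ : ℂ, ∫ y : ℝ, (fockChar k ξ : ℂ) * (conj (η y) * displaceFun ξ ψ y) := by
        simp_rw [inner_displacement, integral_const_mul]
    _ = ∫ y : ℝ, ∫ ξ : ℂ, (fockChar k ξ : ℂ) * (conj (η y) * displaceFun ξ ψ y) :=
        integral_integral_swap hint
    _ = ∫ y : ℝ, (Real.pi * ⟪fock k, ψ⟫_ℂ) * (conj (η y) * fockFun k y) :=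
        integral_congr_ae hy
    _ = _ := by
        rw [integral_const_mul, L2.inner_def η (fock k)]
        have : ∫ y : ℝ, conj (η y) * fockFun k y = ∫ y : ℝ, ⟪η y, fock k y⟫_ℂ := by
          refine integral_congr_ae ?_
          filter_upwards [fock_coeFn k] with y hy
          rw [hy, RCLike.inner_apply, mul_comm]
        rw [this]
        ring

/-! ### Traces against displacement operators -/

lemma countable_basisIndex : Countable basisIndex := by
  have hd : Pairwise fun i j : basisIndex => 1 ≤ dist (i : ModeSpace) (j : ModeSpace) := by
    intro i j hij
    have hb : ∀ i : basisIndex, basis i = (i : ModeSpace) := fun i =>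
      congrFun (exists_hilbertBasis ℂ ModeSpace).choose_spec.choose_spec i
    have h1 : ∀ i : basisIndex, ‖(i : ModeSpace)‖ = 1 := fun i => by
      rw [← hb]
      exact basis.orthonormal.1 i
    have h0 : ⟪(i : ModeSpace), (j : ModeSpace)⟫_ℂ = 0 := by
      rw [← hb, ← hb]
      exact basis.orthonormal.2 hij
    rw [dist_eq_norm]
    have h := norm_sub_sq (𝕜 := ℂ) (i : ModeSpace) (j : ModeSpace)
    rw [h0, h1, h1] at h
    simp only [map_zero] at h
    nlinarith [norm_nonneg ((i : ModeSpace) - j)]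
  have : DiscreteTopology basisIndex :=
    DiscreteTopology.of_forall_le_dist one_pos hd
  have : Fact ((2 : ENNReal) ≠ ⊤) := ⟨ENNReal.ofNat_ne_top⟩
  exact TopologicalSpace.separableSpace_iff_countable.1 inferInstance

lemma enorm_sq_eq_tsum (x : ModeSpace) : ‖x‖ₑ ^ 2 = ∑' i, ‖⟪basis i, x⟫_ℂ‖ₑ ^ 2 := by
  have h := (basis.hasSum_inner_mul_inner x x).mapL reCLM
  have h' : HasSum (fun i => ‖⟪basis i, x⟫_ℂ‖ ^ 2) (‖x‖ ^ 2) := by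
    convert! h using 1
    · funext i
      rw [← inner_conj_symm x, conj_mul']
      simp [← ofReal_pow]
    · rw [inner_self_eq_norm_sq_to_K]
      simp [← ofReal_pow]
  have e := ENNReal.ofReal_tsum_of_nonneg (fun i => sq_nonneg ‖⟪basis i, x⟫_ℂ‖) h'.summable
  rw [h'.tsum_eq] at e
  simpa [ENNReal.ofReal_pow, ofReal_norm] using e

/-- The Hilbert–Schmidt norm of an operator is that of its adjoint. -/
lemma tsum_enorm_sq_adjoint (T : ModeSpace →L[ℂ] ModeSpace) :
    ∑' i, ‖T (basis i)‖ₑ ^ 2 = ∑' i, ‖T.adjoint (basis i)‖ₑ ^ 2 := by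
  simp_rw [enorm_sq_eq_tsum (T _), enorm_sq_eq_tsum (T.adjoint _)]
  rw [ENNReal.tsum_comm]
  refine tsum_congr fun j => tsum_congr fun i => ?_
  rw [ContinuousLinearMap.adjoint_inner_right, ← inner_conj_symm, RCLike.enorm_conj]

lemma norm_displacement_apply (ξ : ℂ) (ψ : ModeSpace) : ‖displacement ξ ψ‖ = ‖ψ‖ := by
  rw [displacement, LinearIsometry.coe_toContinuousLinearMap, LinearIsometry.norm_map]

lemma norm_adjoint_displacement_apply_le (ξ : ℂ) (ψ : ModeSpace) :
    ‖(displacement ξ).adjoint ψ‖ ≤ ‖ψ‖ := by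
  refine ((displacement ξ).adjoint.le_of_opNorm_le ?_ ψ).trans_eq (one_mul _)
  rw [LinearIsometryEquiv.norm_map]
  exact ContinuousLinearMap.opNorm_le_bound _ zero_le_one fun ψ => by
    rw [norm_displacement_apply, one_mul]

lemma exists_isPositive_mul_self_eq {H : Type*} [NormedAddCommGroup H] [InnerProductSpace ℂ H]
    [CompleteSpace H] {T : H →L[ℂ] H} (hT : T.IsPositive) :
    ∃ R : H →L[ℂ] H, R.IsPositive ∧ R * R = T :=
  ⟨CFC.sqrt T, (ContinuousLinearMap.nonneg_iff_isPositive _).1 (CFC.sqrt_nonneg T),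
    CFC.sqrt_mul_sqrt_self T ((ContinuousLinearMap.nonneg_iff_isPositive T).2 hT)⟩

/-- The trace of `ρ D(ξ)` converges absolutely, uniformly in `ξ`. With `ρ = R²` each term is
`⟪R e, R D(ξ) e⟫`, and both `R` and `R D(ξ)` have Hilbert–Schmidt norm at most one. -/
lemma IsDensityOperator.tsum_enorm_le {ρ : ModeSpace →L[ℂ] ModeSpace}
    (hρ : IsDensityOperator ρ) (ξ : ℂ) :
    ∑' i, ‖⟪basis i, ρ (displacement ξ (basis i))⟫_ℂ‖ₑ ≤ 2 := by
  obtain ⟨R, hR, hRR⟩ := exists_isPositive_mul_self_eq hρ.isPositive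
  have hRad : R.adjoint = R := hR.isSelfAdjoint.adjoint_eq
  have hinner : ∀ x y, ⟪x, ρ y⟫_ℂ = ⟪R x, R y⟫_ℂ := fun x y => by
    rw [← hRR, mul_apply_eq_comp, ← ContinuousLinearMap.adjoint_inner_left, hRad]
  have h1 : ∑' i, ‖R (basis i)‖ₑ ^ 2 = 1 := by
    have h := hρ.hasSum_one.mapL reCLM
    have h' : HasSum (fun i => ‖R (basis i)‖ ^ 2) 1 := by
      convert! h using 1
      funext i
      rw [hinner, inner_self_eq_norm_sq_to_K]
      simp [← ofReal_pow]
    have e := ENNReal.ofReal_tsum_of_nonneg (fun i => sq_nonneg ‖R (basis i)‖) h'.summable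
    rw [h'.tsum_eq] at e
    simpa [ENNReal.ofReal_pow, ofReal_norm] using e.symm
  have h2 : ∑' i, ‖R (displacement ξ (basis i))‖ₑ ^ 2 ≤ 1 := by
    have h := tsum_enorm_sq_adjoint (R ∘L displacement ξ)
    simp only [ContinuousLinearMap.adjoint_comp, hRad, ContinuousLinearMap.comp_apply] at h
    rw [h, ← h1]
    refine ENNReal.tsum_le_tsum fun i => ?_
    gcongr
    rw [← ofReal_norm, ← ofReal_norm]
    exact ENNReal.ofReal_le_ofReal (norm_adjoint_displacement_apply_le ξ _)
  -- Any finite bound serves, so the sharp factor `1 / 2` is not needed.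
  have h3 : ∀ a b : ENNReal, a * b ≤ a ^ 2 + b ^ 2 := fun a b => by
    rcases le_total a b with h | h
    · calc a * b ≤ b * b := by gcongr
        _ = b ^ 2 := (sq b).symm
        _ ≤ _ := le_add_self
    · calc a * b ≤ a * a := by gcongr
        _ = a ^ 2 := (sq a).symm
        _ ≤ _ := le_self_add
  calc ∑' i, ‖⟪basis i, ρ (displacement ξ (basis i))⟫_ℂ‖ₑ
      ≤ ∑' i, (‖R (basis i)‖ₑ ^ 2 + ‖R (displacement ξ (basis i))‖ₑ ^ 2) := by
        refine ENNReal.tsum_le_tsum fun i => le_trans ?_ (h3 _ _)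
        rw [hinner, ← ofReal_norm, ← ofReal_norm, ← ofReal_norm,
          ← ENNReal.ofReal_mul (norm_nonneg _)]
        exact ENNReal.ofReal_le_ofReal (norm_inner_le_norm _ _)
    _ ≤ 1 + 1 := by
        rw [ENNReal.tsum_add, h1]
        gcongr
    _ = 2 := one_add_one_eq_two

lemma IsDensityOperator.summable_norm {ρ : ModeSpace →L[ℂ] ModeSpace}
    (hρ : IsDensityOperator ρ) (ξ : ℂ) :
    Summable fun i => ‖⟪basis i, ρ (displacement ξ (basis i))⟫_ℂ‖ := by
  have h := (hρ.tsum_enorm_le ξ).trans_lt ENNReal.ofNat_lt_top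
  exact NNReal.summable_coe.2 (ENNReal.tsum_coe_ne_top_iff_summable.1 h.ne)

lemma IsDensityOperator.norm_trace_le {ρ : ModeSpace →L[ℂ] ModeSpace}
    (hρ : IsDensityOperator ρ) (ξ : ℂ) : ‖trace (ρ ∘L displacement ξ)‖ ≤ 2 := by
  refine (norm_tsum_le_tsum_norm (hρ.summable_norm ξ)).trans ?_
  have h := hρ.tsum_enorm_le ξ
  simp_rw [← ofReal_norm] at h
  rw [← ENNReal.ofReal_tsum_of_nonneg (fun _ => norm_nonneg _) (hρ.summable_norm ξ)] at h
  exact (ENNReal.ofReal_le_ofReal_iff zero_le_two).1 (h.trans_eq (ENNReal.ofReal_ofNat 2).symm)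

lemma IsDensityOperator.inner_apply_comm {ρ : ModeSpace →L[ℂ] ModeSpace}
    (hρ : IsDensityOperator ρ) (x y : ModeSpace) : ⟪x, ρ y⟫_ℂ = ⟪ρ x, y⟫_ℂ := by
  rw [← ContinuousLinearMap.adjoint_inner_left, hρ.isPositive.isSelfAdjoint.adjoint_eq]

lemma IsDensityOperator.aestronglyMeasurable_trace {ρ : ModeSpace →L[ℂ] ModeSpace}
    (hρ : IsDensityOperator ρ) :
    AEStronglyMeasurable (fun ξ => trace (ρ ∘L displacement ξ)) volume := by
  have := countable_basisIndex
  refine aestronglyMeasurable_of_tendsto_ae Filter.atTop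
    (f := fun (t : Finset basisIndex) ξ => ∑ i ∈ t, ⟪basis i, ρ (displacement ξ (basis i))⟫_ℂ)
    (fun t => ?_) (Filter.Eventually.of_forall fun ξ => (hρ.summable_norm ξ).of_norm.hasSum)
  simp_rw [hρ.inner_apply_comm]
  exact Finset.aestronglyMeasurable_fun_sum _ fun i _ =>
    (stronglyMeasurable_inner_displacement _ _).aestronglyMeasurable

lemma IsDensityOperator.locallyIntegrable_charFun {ρ : ModeSpace →L[ℂ] ModeSpace}
    (hρ : IsDensityOperator ρ) (s : ℝ) : LocallyIntegrable (charFun s ρ) := by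
  have hc : Continuous fun ξ : ℂ => 2 * Real.exp (s * ‖ξ‖ ^ 2 / 2) := by fun_prop
  refine hc.locallyIntegrable.mono ?_ (Filter.Eventually.of_forall fun ξ => ?_)
  · exact (Continuous.aestronglyMeasurable (by fun_prop)).mul hρ.aestronglyMeasurable_trace
  · rw [charFun, norm_mul, norm_real, norm_mul, Real.norm_of_nonneg zero_le_two, mul_comm]
    exact mul_le_mul_of_nonneg_right (hρ.norm_trace_le ξ) (norm_nonneg _)

/-- Occupation probabilities from the characteristic function. -/
lemma IsDensityOperator.integral_fockChar_mul_trace {ρ : ModeSpace →L[ℂ] ModeSpace}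
    (hρ : IsDensityOperator ρ) {k : ℝ} (hk : k = 0 ∨ k = 1) :
    ∫ ξ : ℂ, (fockChar k ξ : ℂ) * trace (ρ ∘L displacement ξ) =
      Real.pi * ⟪fock k, ρ (fock k)⟫_ℂ := by
  have := countable_basisIndex
  have hm : ∀ i, AEStronglyMeasurable (fun ξ : ℂ => (fockChar k ξ : ℂ) *
      ⟪basis i, ρ (displacement ξ (basis i))⟫_ℂ) volume := fun i => by
    simp_rw [hρ.inner_apply_comm]
    exact (integrable_fockChar k).ofReal.1.mul
      (stronglyMeasurable_inner_displacement _ _).aestronglyMeasurable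
  have hfin : ∑' i, ∫⁻ ξ : ℂ, ‖(fockChar k ξ : ℂ) *
      ⟪basis i, ρ (displacement ξ (basis i))⟫_ℂ‖ₑ ≠ ⊤ := by
    rw [← lintegral_tsum fun i => (hm i).enorm]
    refine ne_top_of_le_ne_top (b := ∫⁻ ξ : ℂ, ‖(fockChar k ξ : ℂ)‖ₑ * 2) ?_ ?_
    · rw [lintegral_mul_const' _ _ ENNReal.ofNat_ne_top]
      exact ENNReal.mul_ne_top (integrable_fockChar k).ofReal.2.ne ENNReal.ofNat_ne_top
    · refine lintegral_mono fun ξ => ?_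
      simp_rw [enorm_mul]
      rw [ENNReal.tsum_mul_left]
      gcongr
      exact hρ.tsum_enorm_le ξ
  calc ∫ ξ : ℂ, (fockChar k ξ : ℂ) * trace (ρ ∘L displacement ξ)
      = ∫ ξ : ℂ, ∑' i, (fockChar k ξ : ℂ) * ⟪basis i, ρ (displacement ξ (basis i))⟫_ℂ := by
        simp_rw [trace, tsum_mul_left, ContinuousLinearMap.comp_apply]
    _ = ∑' i, ∫ ξ : ℂ, (fockChar k ξ : ℂ) * ⟪basis i, ρ (displacement ξ (basis i))⟫_ℂ :=
        integral_tsum hm hfin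
    _ = ∑' i, Real.pi * (⟪fock k, basis i⟫_ℂ * ⟪basis i, ρ (fock k)⟫_ℂ) := by
        refine tsum_congr fun i => ?_
        simp_rw [hρ.inner_apply_comm]
        rw [integral_fockChar_mul_inner hk, mul_comm ⟪fock k, _⟫_ℂ]
    _ = _ := by rw [tsum_mul_left, basis.tsum_inner_mul_inner]

lemma IsDensityOperator.re_integral_fockChar_mul_trace_nonneg
    {ρ : ModeSpace →L[ℂ] ModeSpace} (hρ : IsDensityOperator ρ) {k : ℝ} (hk : k = 0 ∨ k = 1) :
    0 ≤ (∫ ξ : ℂ, (fockChar k ξ : ℂ) * trace (ρ ∘L displacement ξ)).re := by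
  rw [hρ.integral_fockChar_mul_trace hk, re_ofReal_mul]
  exact mul_nonneg Real.pi_pos.le (hρ.isPositive.re_inner_nonneg_right _)

lemma trace_rankOne_comp (φ : ModeSpace) (T : ModeSpace →L[ℂ] ModeSpace) :
    HasSum (fun i => ⟪basis i, InnerProductSpace.rankOne ℂ φ φ (T (basis i))⟫_ℂ) ⟪φ, T φ⟫_ℂ := by
  have h := basis.hasSum_inner_mul_inner (T.adjoint φ) φ
  rw [ContinuousLinearMap.adjoint_inner_left] at h
  convert! h using 1
  funext i
  rw [InnerProductSpace.rankOne_apply, inner_smul_right, ContinuousLinearMap.adjoint_inner_left]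

lemma isDensityOperator_rankOne_fock {k : ℝ} (hk : k = 0 ∨ k = 1) :
    IsDensityOperator (InnerProductSpace.rankOne ℂ (fock k) (fock k)) where
  isPositive := InnerProductSpace.isPositive_rankOne_self _
  hasSum_one := by
    have h := trace_rankOne_comp (fock k) (ContinuousLinearMap.id ℂ ModeSpace)
    rw [ContinuousLinearMap.id_apply, inner_fock_self hk] at h
    exact h

lemma charFun_rankOne_fock {k : ℝ} (hk : k = 0 ∨ k = 1) (s : ℝ) (ξ : ℂ) :
    charFun s (InnerProductSpace.rankOne ℂ (fock k) (fock k)) ξ =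
      ((Real.exp (s * ‖ξ‖ ^ 2 / 2) * fockChar k ξ : ℝ) : ℂ) := by
  have h := (trace_rankOne_comp (fock k) (displacement ξ)).tsum_eq
  rw [charFun, ofReal_mul, ← inner_fock_displacement_fock hk, ← h]
  rfl

/-! ### The quasiprobability determines the characteristic function -/

open FourierTransform in
/-- The Fourier transform of phase space in terms of the standard Fourier transform of the real
inner product space `ℂ`: since `α ξ* - α* ξ = 2 i ⟪ξ, -i α⟫`, the two differ by a rotation and a
dilation. -/
lemma fourierPS_eq_fourierInv (g : ℂ → ℂ) (α : ℂ) :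
    fourierPS g α = (Real.pi : ℂ)⁻¹ * 𝓕⁻ g (Real.pi⁻¹ • (-I * α)) := by
  rw [fourierPS, Real.fourierInv_eq']
  congr 1
  refine integral_congr_ae (Filter.Eventually.of_forall fun ξ => ?_)
  dsimp only
  rw [smul_eq_mul, inner_smul_right]
  congr 2
  have : 2 * Real.pi * (Real.pi⁻¹ * ⟪ξ, -I * α⟫_ℝ) = 2 * ⟪ξ, -I * α⟫_ℝ := by
    field_simp
  rw [this, Complex.inner]
  apply Complex.ext
  · simp
  · simp
    ring

open FourierTransform in
lemma fourierPS_fourierPS {φ : ℂ → ℂ} (hφ : ContDiff ℝ ∞ φ) (hc : HasCompactSupport φ) :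
    fourierPS (fourierPS φ) = φ := by
  funext ξ
  have hinv : 𝓕 (𝓕⁻ φ) = φ := by
    have h : 𝓕 (𝓕⁻ (hc.toSchwartzMap hφ)) = hc.toSchwartzMap hφ :=
      FourierTransform.fourier_fourierInv_eq _
    have h' := congrArg (fun f : SchwartzMap ℂ ℂ => (f : ℂ → ℂ)) h
    simp only [SchwartzMap.fourier_coe, SchwartzMap.fourierInv_coe] at h'
    exact h'
  have hπ : (Real.pi : ℂ) ≠ 0 := ofReal_ne_zero.2 Real.pi_ne_zero
  let i : Circle := ⟨I, by simp [Submonoid.unitSphere]⟩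
  -- The substitution `α = π i w` turns the outer transform into the standard one.
  set H : ℂ → ℂ := fun α => cexp (ξ * conj α - conj ξ * α) * fourierPS φ α with hH
  have h1 : ∫ α : ℂ, H α = (Real.pi : ℂ) ^ 2 * ∫ w : ℂ, H (Real.pi • (I * w)) := by
    have e1 := Measure.integral_comp_smul (volume : Measure ℂ) H Real.pi
    have e2 := (rotation i).measurePreserving.integral_comp
      (rotation i).toHomeomorph.measurableEmbedding (fun w : ℂ => H (Real.pi • w))
    simp only [rotation_apply] at e2
    change ∫ w : ℂ, H (Real.pi • (I * w)) = _ at e2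
    rw [e2, e1, finrank_real_complex, abs_of_nonneg (by positivity), real_smul]
    push_cast
    field_simp
  have h2 : ∀ w : ℂ, H (Real.pi • (I * w)) =
      (Real.pi : ℂ)⁻¹ * (cexp (((-2 * Real.pi * ⟪w, ξ⟫_ℝ : ℝ) : ℂ) * I) • 𝓕⁻ φ w) := by
    intro w
    have e1 : Real.pi⁻¹ • (-I * (Real.pi • (I * w))) = w := by
      rw [real_smul, real_smul]
      push_cast
      field_simp
      linear_combination (-w) * I_sq
    have e2 : ξ * conj (Real.pi • (I * w)) - conj ξ * (Real.pi • (I * w)) =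
        ((-2 * Real.pi * ⟪w, ξ⟫_ℝ : ℝ) : ℂ) * I := by
      rw [Complex.inner]
      apply Complex.ext
      · simp
        ring
      · simp
        ring
    rw [hH]
    dsimp only
    rw [fourierPS_eq_fourierInv, e1, e2, smul_eq_mul]
    ring
  rw [fourierPS, h1]
  simp_rw [h2]
  rw [integral_const_mul]
  have h3 := congrFun hinv ξ
  rw [Real.fourier_eq'] at h3
  rw [h3]
  field_simp

/-- Two density operators whose quasiprobabilities are related by scaling have characteristic
functions related by scaling. -/
lemma charFun_ae_eq_of_scale_eq {s a : ℝ} (ha : a ≠ 0) {ρ σ : ModeSpace →L[ℂ] ModeSpace}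
    (hρ : IsDensityOperator ρ) (hσ : IsDensityOperator σ)
    (h : (quasiprobability s ρ).scale a ha = quasiprobability s σ) :
    ∀ᵐ ξ : ℂ, charFun s ρ (a • ξ) = charFun s σ ξ := by
  have hloc : LocallyIntegrable fun ξ : ℂ => charFun s ρ (a • ξ) := by
    refine (locallyIntegrable_map_homeomorph (Homeomorph.smulOfNeZero a ha : ℂ ≃ₜ ℂ)
      (f := charFun s ρ)).1 ?_
    change LocallyIntegrable (charFun s ρ) (Measure.map (a • ·) volume)
    rw [Measure.map_addHaar_smul _ ha]
    intro x
    obtain ⟨t, ht, hi⟩ := hρ.locallyIntegrable_charFun s x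
    refine ⟨t, ht, ?_⟩
    rw [IntegrableOn, Measure.restrict_smul]
    exact Integrable.smul_measure hi ENNReal.ofReal_ne_top
  refine ae_eq_of_integral_contDiff_smul_eq hloc (hσ.locallyIntegrable_charFun s)
    fun g hg hgc => ?_
  have hφ : ContDiff ℝ ∞ fun ξ : ℂ => ((g (-ξ) : ℝ) : ℂ) :=
    ofRealCLM.contDiff.comp (hg.comp contDiff_neg)
  have hφc : HasCompactSupport fun ξ : ℂ => ((g (-ξ) : ℝ) : ℂ) :=
    (hgc.comp_homeomorph (Homeomorph.neg ℂ)).comp_left (g := ((↑) : ℝ → ℂ)) ofReal_zero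
  set f : TestFunction := ⟨_, _, hφ, hφc, rfl⟩
  have hff : fourierPS f.toFun = fun ξ : ℂ => ((g (-ξ) : ℝ) : ℂ) := fourierPS_fourierPS hφ hφc
  have hdil : ∀ ξ : ℂ, fourierPS (f.dilate a ha).toFun ξ =
      ((a ^ 2)⁻¹ : ℝ) * fourierPS f.toFun (a⁻¹ • ξ) := by
    intro ξ
    have e := Measure.integral_comp_smul (volume : Measure ℂ)
      (fun α : ℂ => cexp ((a⁻¹ • ξ) * conj α - conj (a⁻¹ • ξ) * α) * f.toFun α) a
    rw [finrank_real_complex, abs_of_nonneg (by positivity)] at e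
    rw [fourierPS, fourierPS, mul_left_comm, ← real_smul (x := (a ^ 2)⁻¹), ← e]
    congr 1
    refine integral_congr_ae (Filter.Eventually.of_forall fun α => ?_)
    have ha' : (a : ℂ) ≠ 0 := ofReal_ne_zero.2 ha
    dsimp only [TestFunction.dilate]
    congr 2
    simp only [real_smul, map_mul, conj_ofReal]
    push_cast
    field_simp
  have h1 := congrFun h f
  simp only [GeneralizedFunction.scale, quasiprobability, hdil, hff, smul_neg, neg_neg] at h1
  have e := Measure.integral_comp_smul (volume : Measure ℂ)
    (fun ξ : ℂ => charFun s ρ ξ * ((g (a⁻¹ • ξ) : ℝ) : ℂ)) a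
  rw [finrank_real_complex, abs_of_nonneg (by positivity),
    real_smul (x := (a ^ 2)⁻¹), ← integral_const_mul] at e
  simp only [inv_smul_smul₀ ha] at e
  have hg_smul : ∀ (ξ z : ℂ), g ξ • z = z * ((g ξ : ℝ) : ℂ) := fun ξ z => by
    rw [real_smul, mul_comm]
  simp_rw [hg_smul]
  rw [← h1, e]
  refine integral_congr_ae (Filter.Eventually.of_forall fun ξ => ?_)
  dsimp only
  ring

/-! ### Negative occupation probabilities -/

/-- Scaling the Fock state `|k⟩` would give `|1 - k⟩` the occupation probability
`(c - B) / c²`, where `B = a²` for `k = 1` and `B = 1` for `k = 0`. -/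
lemma not_isPositiveScalingMap_of_lt {s a : ℝ} (ha : a ≠ 0) {k : ℝ} (hk : k = 0 ∨ k = 1)
    {c : ℝ} (hc : c = (1 + s + a ^ 2 * (1 - s)) / 2) (hc0 : 0 < c)
    (hlt : c < 1 - k + k * a ^ 2) : ¬ IsPositiveScalingMap s a ha := by
  intro hpos
  -- The test state is `|1 - k⟩`; at most one of the two polynomial factors is not constant.
  have hm : 1 - k = 0 ∨ 1 - k = 1 := by
    rcases hk with rfl | rfl <;> norm_num
  have hmk : (1 - k) * k = 0 := by
    rcases hk with rfl | rfl <;> norm_num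
  have hρ := isDensityOperator_rankOne_fock hk
  obtain ⟨σ, hσ, h⟩ := hpos _ ⟨_, hρ, rfl⟩
  have hnn := hσ.re_integral_fockChar_mul_trace_nonneg hm
  have hint : ∫ ξ : ℂ, (fockChar (1 - k) ξ : ℂ) * trace (σ ∘L displacement ξ) =
      ∫ ξ : ℂ, (((1 + -(1 - k + k * a ^ 2) * ‖ξ‖ ^ 2) * Real.exp (-c * ‖ξ‖ ^ 2) : ℝ) : ℂ) := by
    refine integral_congr_ae ?_
    filter_upwards [charFun_ae_eq_of_scale_eq ha hρ hσ h] with ξ hξ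
    have hn : ‖a • ξ‖ ^ 2 = a ^ 2 * ‖ξ‖ ^ 2 := by
      rw [norm_smul, mul_pow, Real.norm_eq_abs, sq_abs]
    have htr : trace (σ ∘L displacement ξ) = ((Real.exp (-(s * ‖ξ‖ ^ 2 / 2)) *
        (Real.exp (s * (a ^ 2 * ‖ξ‖ ^ 2) / 2) * fockChar k (a • ξ)) : ℝ) : ℂ) := by
      rw [charFun_rankOne_fock hk, charFun, hn] at hξ
      rw [ofReal_mul, hξ, ← mul_assoc, ← ofReal_mul, ← Real.exp_add, neg_add_cancel,
        Real.exp_zero, ofReal_one, one_mul]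
    have hexp : Real.exp (-c * ‖ξ‖ ^ 2) = Real.exp (-‖ξ‖ ^ 2 / 2) *
        (Real.exp (-(s * ‖ξ‖ ^ 2 / 2)) * (Real.exp (s * (a ^ 2 * ‖ξ‖ ^ 2) / 2) *
          Real.exp (-(a ^ 2 * ‖ξ‖ ^ 2) / 2))) := by
      rw [← Real.exp_add, ← Real.exp_add, ← Real.exp_add, hc]
      congr 1
      ring
    rw [htr, ← ofReal_mul, fockChar, fockChar, hn, hexp]
    congr 1
    linear_combination (a ^ 2 * ‖ξ‖ ^ 4 * (Real.exp (-‖ξ‖ ^ 2 / 2) *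
        (Real.exp (-(s * ‖ξ‖ ^ 2 / 2)) * (Real.exp (s * (a ^ 2 * ‖ξ‖ ^ 2) / 2) *
          Real.exp (-(a ^ 2 * ‖ξ‖ ^ 2) / 2))))) * hmk
  rw [hint, integral_complex_ofReal, ofReal_re, integral_quadratic_mul_exp_neg_norm_sq hc0] at hnn
  refine hnn.not_gt (mul_neg_of_pos_of_neg Real.pi_pos ?_)
  have : 1 / c + -(1 - k + k * a ^ 2) / c ^ 2 = (c - (1 - k + k * a ^ 2)) / c ^ 2 := by
    field_simp
    ring
  rw [this]
  exact div_neg_of_neg_of_pos (sub_neg.2 hlt) (by positivity)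

end ScalingMap

theorem proposition2 (s a : ℝ) (ha : a ≠ 0)
    (h : (-1 < s ∧ s < 1 ∧ |a| ≠ 1) ∨ (s = -1 ∧ |a| < 1) ∨ (s = 1 ∧ 1 < |a|)) :
    ¬ ScalingMap.IsPositiveScalingMap s a ha := by
  have ha2 : 0 < a ^ 2 := by positivity
  have hcases : (|a| < 1 ∧ -1 ≤ s ∧ s < 1) ∨ (1 < |a| ∧ -1 < s ∧ s ≤ 1) := by
    rcases h with ⟨h1, h2, h3⟩ | ⟨rfl, h1⟩ | ⟨rfl, h1⟩
    · rcases lt_or_gt_of_ne h3 with h3 | h3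
      · exact Or.inl ⟨h3, h1.le, h2⟩
      · exact Or.inr ⟨h3, h1, h2.le⟩
    · exact Or.inl ⟨h1, le_rfl, by norm_num⟩
    · exact Or.inr ⟨h1, by norm_num, le_rfl⟩
  rcases hcases with ⟨h1, h2, h3⟩ | ⟨h1, h2, h3⟩
  · have h4 : a ^ 2 < 1 := (sq_lt_one_iff_abs_lt_one a).2 h1
    refine ScalingMap.not_isPositiveScalingMap_of_lt ha (Or.inl rfl) rfl ?_ ?_
    · nlinarith
    · nlinarith
  · have h4 : 1 < a ^ 2 := (one_lt_sq_iff_one_lt_abs a).2 h1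
    refine ScalingMap.not_isPositiveScalingMap_of_lt ha (Or.inr rfl) rfl ?_ ?_
    · nlinarith
    · nlinarith
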